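/- A tournament $T=(V,E)$ is a (possibly infinite) set $V$ of vertices with an irreflexive, antisymmetric and complete binary relation $E\subseteq V\times V$ (so that for any two distinct vertices $x,y$ exactly one of $(x,y),(y,x)$ belongs to $E$). A set $A\subseteq V$ is autonomous if for all $x,x'\in A$ and $y\in V\setminus A$ one has $(x,y)\in E$ if and only if $(x',y)\in E$; the tournament $T$ is indecomposable if its only autonomous sets are $\emptyset$, the singletons and $V$. The profile of $T$ is the function $\varphi_T$ whose value $\varphi_T(n)$ at each integer $n\ge 0$ is the number of subtournaments induced by $T$ on the $n$-element subsets of $V$, counted up to isomorphism. Corollary. The growth of the profile of every infinite indecomposable tournament is at least exponential: if $T$ is an indecomposable tournament with infinite vertex set, then there are real numbers $a>0$ and $c>1$ such that $\varphi_T(n)\geq a\,c^n$ for every integer $n\geq 0$. -/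

import Mathlib

/-- A tournament on the vertex type `V`: a directed graph whose edge relation is irreflexive,
antisymmetric and complete. -/
structure Tournament (V : Type*) extends Digraph V where
  irrefl : ∀ x, ¬ Adj x x
  antisymm : ∀ x y, Adj x y → Adj y x → x = y
  complete : ∀ x y, x ≠ y → Adj x y ∨ Adj y x

namespace Tournament

/-- Isomorphisms of tournaments: bijections preserving and reflecting the edge relation. -/
abbrev Iso {V W : Type*} (T : Tournament V) (S : Tournament W) := T.Adj ≃r S.Adj

/-- The subtournament of `T` induced on the set of vertices `A`. -/
def induce {V : Type*} (T : Tournament V) (A : Set V) : Tournament A where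
  Adj x y := T.Adj x y
  irrefl x := T.irrefl x
  antisymm x y h h' := Subtype.ext (T.antisymm x y h h')
  complete x y h := T.complete x y (fun e => h (Subtype.ext e))

/-- A set of vertices is autonomous if no vertex outside of it distinguishes two of its members. -/
def IsAutonomous {V : Type*} (T : Tournament V) (A : Set V) : Prop :=
  ∀ x ∈ A, ∀ x' ∈ A, ∀ y ∉ A, (T.Adj x y ↔ T.Adj x' y)

/-- A tournament is indecomposable (or simple) if its only autonomous sets are the trivial ones:
the empty set, the singletons and the whole vertex set. -/
def IsIndecomposable {V : Type*} (T : Tournament V) : Prop :=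
  ∀ A : Set V, T.IsAutonomous A → A = ∅ ∨ (∃ x, A = {x}) ∨ A = Set.univ

/-- On the `n`-element sets of vertices, the equivalence relation
"the induced subtournaments are isomorphic". -/
def isoSetoid {V : Type*} (T : Tournament V) (n : ℕ) : Setoid {A : Finset V // A.card = n} where
  r A B := Nonempty ((T.induce (A.1 : Set V)).Iso (T.induce (B.1 : Set V)))
  iseqv :=
    { refl := fun _ => ⟨RelIso.refl _⟩
      symm := fun ⟨f⟩ => ⟨f.symm⟩
      trans := fun ⟨f⟩ ⟨g⟩ => ⟨f.trans g⟩ }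

/-- There are only finitely many isomorphism types of subtournaments induced on `n` vertices, so
that the cardinality in the definition of the profile below is a genuine one. -/
instance finite_quotient_isoSetoid {V : Type*} (T : Tournament V) (n : ℕ) :
    Finite (Quotient (T.isoSetoid n)) := by
  classical
  let e : (A : {A : Finset V // A.card = n}) → A.1 ≃ Fin n := fun A => A.1.equivFinOfCardEq A.2
  let F : Quotient (T.isoSetoid n) → (Fin n → Fin n → Prop) := fun q i j =>
    T.Adj ((e q.out).symm i) ((e q.out).symm j)
  refine Finite.of_injective F fun p q h => ?_
  rw [← Quotient.out_eq p, ← Quotient.out_eq q]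
  refine Quotient.sound ⟨⟨(e p.out).trans (e q.out).symm, ?_⟩⟩
  intro a b
  have := congrFun (congrFun h (e p.out a)) (e p.out b)
  simp only [F, Equiv.symm_apply_apply] at this
  exact (iff_of_eq this).symm

/-- The profile of `T`: the number of subtournaments induced by `T` on the `n`-element sets of
vertices, isomorphic ones being identified. -/
noncomputable def profile {V : Type*} (T : Tournament V) (n : ℕ) : ℕ :=
  Nat.card (Quotient (T.isoSetoid n))

end Tournament

/-- The growth of `f` is at least exponential. -/
def GrowthAtLeastExponential (f : ℕ → ℕ) : Prop :=
  ∃ a c : ℝ, 0 < a ∧ 1 < c ∧ ∀ n : ℕ, a * c ^ n ≤ (f n : ℝ)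

/-! By Ramsey, and up to reversing all edges, there is an infinite chain. Cut it into consecutive
pairs x → y. Indecomposability, applied to the interval from x to y, yields a three-cycle through x
→ y, or through x → u or u → y for some u with x → u → y. A second use of Ramsey makes the relations
between different columns (x, y, u, z) uniform. Either the added vertices keep the place of their
column, and there is a sum of three-cycles over a chain (`growth_of_sum_threeCycles`), or some
sequence interleaves or matches with a chain and a single point separates the two
(`growth_of_separated`); `before_of_not_growth` sorts these cases out.

Both configurations code binary words: 2m letters cut a chain differently, and a word selects m of
them. Once one vertex is marked, the isomorphism type determines the word, whence 2^m ≤ n φ(n) with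
m linear in n. The factor n pays for the mark and is absorbed by the exponential. -/

/-- The infinite Ramsey theorem for pairs and finitely many colours. -/
theorem exists_strictMono_monochromatic {κ : Type*} [Finite κ] (f : ℕ → ℕ → κ) :
    ∃ (φ : ℕ → ℕ) (c : κ), StrictMono φ ∧ ∀ i j, i < j → f (φ i) (φ j) = c := by
  -- A nonprincipal ultrafilter gives each `i` a limit colour `d i`, and these a limit colour `c`;
  -- indices with `d i = c` can then be chosen greedily.
  let U : Ultrafilter ℕ := Filter.hyperfilter ℕ
  have lim (g : ℕ → κ) : ∃ c, ∀ᶠ j in (U : Filter ℕ), g j = c := by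
    obtain ⟨c, hc⟩ := Ultrafilter.eq_pure_of_finite (U.map g)
    refine ⟨c, ?_⟩
    have : {c} ∈ U.map g := by rw [hc]; exact Set.mem_singleton c
    exact this
  choose d hd using fun i => lim (f i)
  obtain ⟨c, hc⟩ := lim d
  obtain ⟨φ, -, h⟩ := exists_seq_of_forall_finset_exists (fun i => d i = c)
    (fun i j => i < j ∧ f i j = c) (fun s hs => by
      have h1 : ∀ᶠ j in (U : Filter ℕ), ∀ i ∈ s, i < j ∧ f i j = c := by
        rw [Filter.eventually_all_finset]
        intro i hi
        have hgt : ∀ᶠ j in (U : Filter ℕ), i < j := by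
          have := Filter.eventually_gt_atTop i
          rw [← Nat.cofinite_eq_atTop] at this
          exact this.filter_mono Filter.hyperfilter_le_cofinite
        filter_upwards [hgt, hd i] with j h1 h2
        exact ⟨h1, h2.trans (hs i hi)⟩
      exact (hc.and h1).exists)
  exact ⟨φ, c, fun i j hij => (h i j hij).1, fun i j hij => (h i j hij).2⟩

namespace Tournament

variable {V : Type*} (T : Tournament V)

/-! ### Edges and duality -/

theorem adj_of_not_adj {x y : V} (hxy : x ≠ y) (h : ¬ T.Adj x y) : T.Adj y x :=
  (T.complete x y hxy).resolve_left h

theorem not_adj_of_adj {x y : V} (h : T.Adj x y) : ¬ T.Adj y x := fun h' =>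
  T.irrefl x ((T.antisymm x y h h') ▸ h)

theorem ne_of_adj {x y : V} (h : T.Adj x y) : x ≠ y := by
  rintro rfl
  exact T.irrefl _ h

/-- The tournament with all the edges reversed. -/
def dual : Tournament V where
  Adj x y := T.Adj y x
  irrefl := T.irrefl
  antisymm x y h h' := T.antisymm x y h' h
  complete x y h := (T.complete x y h).symm

theorem profile_dual : T.dual.profile = T.profile := by
  funext n
  refine Nat.card_congr (Quotient.congr (Equiv.refl _) fun A B => ?_)
  exact ⟨fun ⟨e⟩ => ⟨⟨e.toEquiv, fun {a b} => e.map_rel_iff (a := b) (b := a)⟩⟩,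
    fun ⟨e⟩ => ⟨⟨e.toEquiv, fun {a b} => e.map_rel_iff (a := b) (b := a)⟩⟩⟩

variable {T} in
theorem IsIndecomposable.dual (hT : T.IsIndecomposable) : T.dual.IsIndecomposable := by
  intro A hA
  refine hT A fun x hx x' hx' y hy => ?_
  have key : ∀ u ∈ A, ∀ v ∈ A, T.Adj u y → T.Adj v y := fun u hu v hv h =>
    T.adj_of_not_adj (fun e => hy (e ▸ hv))
      fun h' => T.not_adj_of_adj h ((hA v hv u hu y hy).1 h')
  exact ⟨key x hx x' hx', key x' hx' x hx⟩

theorem profile_pos [Infinite V] (n : ℕ) : 0 < T.profile n := by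
  obtain ⟨A, hA⟩ := Infinite.exists_subset_card_eq V n
  have : Nonempty (Quotient (T.isoSetoid n)) := ⟨Quotient.mk _ ⟨A, hA⟩⟩
  exact Nat.card_pos

/-! ### Counting coded words -/

/-- If the isomorphisms fixing a given point tell the members of a family of subtournaments apart,
then the family is not much larger than the profile. -/
theorem card_le_mul_profile {ι Ω : Type*} [Fintype ι] (g : Ω → ι ↪ V) (p : ι)
    (h : ∀ (w w' : Ω) (e : ι ≃ ι), e p = p →
      (∀ i j, T.Adj (g w i) (g w j) ↔ T.Adj (g w' (e i)) (g w' (e j))) → w = w') :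
    Nat.card Ω ≤ Fintype.card ι * T.profile (Fintype.card ι) := by
  classical
  let A : Ω → {A : Finset V // A.card = Fintype.card ι} := fun w =>
    ⟨Finset.univ.map (g w), by rw [Finset.card_map, Finset.card_univ]⟩
  let q : Ω → Quotient (T.isoSetoid (Fintype.card ι)) := fun w => Quotient.mk _ (A w)
  let c : ∀ w, ι ≃ ((A w).1 : Set V) := fun w =>
    (Equiv.ofInjective (g w) (g w).injective).trans (Equiv.setCongr (by ext; simp [A]))
  have hc : ∀ w i, ((c w i : ((A w).1 : Set V)) : V) = g w i := fun w i => rfl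
  have hiso : ∀ w, Nonempty ((T.induce ((A w).1 : Set V)).Iso (T.induce ((q w).out.1 : Set V))) :=
    fun w => Quotient.exact (Quotient.out_eq (q w)).symm
  let f := fun w => (hiso w).some
  let N := fun r : Quotient (T.isoSetoid (Fintype.card ι)) => r.out.1.equivFinOfCardEq r.out.2
  -- The class, together with the place of `p` in its representative: members with the same value
  -- are linked by an isomorphism fixing `p`.
  let F : Ω → Fin (Fintype.card ι) × Quotient (T.isoSetoid (Fintype.card ι)) := fun w =>
    (N (q w) (f w (c w p)), q w)
  have hF : Function.Injective F := by
    intro w w' hw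
    have hq : q w = q w' := congrArg Prod.snd hw
    have hp : N (q w) (f w (c w p)) = N (q w') (f w' (c w' p)) := congrArg Prod.fst hw
    -- The classes are variables here so that their equality can be substituted in the types of `f`
    -- and `f'`.
    have key : ∀ (r r' : Quotient (T.isoSetoid (Fintype.card ι))) (_ : r = r')
        (f : (T.induce ((A w).1 : Set V)).Iso (T.induce (r.out.1 : Set V)))
        (f' : (T.induce ((A w').1 : Set V)).Iso (T.induce (r'.out.1 : Set V))),
        N r (f (c w p)) = N r' (f' (c w' p)) → w = w' := by
      rintro r _ rfl f f' hp
      have hp' : f (c w p) = f' (c w' p) := (N r).injective hp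
      refine h w w' (((c w).trans (f.trans f'.symm).toEquiv).trans (c w').symm) ?_ ?_
      · simp [hp']
      · intro i j
        have := (f.trans f'.symm).map_rel_iff (a := c w i) (b := c w j)
        rw [← hc w', ← hc w']
        simp only [Equiv.trans_apply, Equiv.apply_symm_apply]
        exact this.symm
    exact key _ _ hq _ _ hp
  calc Nat.card Ω ≤ Nat.card (Fin (Fintype.card ι) × Quotient (T.isoSetoid (Fintype.card ι))) :=
        Nat.card_le_card_of_injective F hF
    _ = _ := by rw [Nat.card_prod, Nat.card_fin]; rfl

/-- An exponential lower bound on the profile, up to a linear factor and a rounded exponent. -/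
theorem growthAtLeastExponential_of_two_pow_le [Infinite V] (L : ℕ) (hL : 0 < L)
    (h : ∀ n, 0 < n → 2 ^ ((n - 1) / L) ≤ n * T.profile n) :
    GrowthAtLeastExponential T.profile := by
  -- Half of the available exponent: ρ^(2n) is at most 2 · 2^((n-1)/L), and one factor ρ^n is spent
  -- on absorbing n.
  set ρ : ℝ := 2 ^ ((2 * L : ℝ)⁻¹) with hρ
  have hL' : (0 : ℝ) < 2 * L := by positivity
  have hρ1 : 1 < ρ := Real.one_lt_rpow (by norm_num) (by positivity)
  have hρ2 : ρ ^ (2 * L) = 2 := by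
    rw [hρ, ← Real.rpow_natCast, ← Real.rpow_mul (by norm_num)]
    push_cast
    rw [inv_mul_cancel₀ hL'.ne', Real.rpow_one]
  -- Needed only for n = 0, where (ρ - 1) / 2 must not exceed 1.
  have hρ3 : ρ ≤ 2 := by
    rw [← hρ2]
    exact le_self_pow₀ hρ1.le (by omega)
  refine ⟨(ρ - 1) / 2, ρ, by linarith, hρ1, fun n => ?_⟩
  rcases Nat.eq_zero_or_pos n with rfl | hn
  · have : (1 : ℝ) ≤ T.profile 0 := by exact_mod_cast T.profile_pos 0
    rw [pow_zero]
    linarith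
  · have h1 : n ≤ L * ((n - 1) / L + 1) := by
      have := Nat.lt_mul_div_succ (n - 1) hL
      omega
    have h2 : ρ ^ n * ρ ^ n ≤ 2 * 2 ^ ((n - 1) / L) := by
      calc ρ ^ n * ρ ^ n = ρ ^ (2 * n) := by rw [← pow_add, two_mul]
        _ ≤ ρ ^ (2 * L * ((n - 1) / L + 1)) := by
          refine pow_le_pow_right₀ hρ1.le ?_
          rw [mul_assoc]
          exact Nat.mul_le_mul_left 2 h1
        _ = 2 * 2 ^ ((n - 1) / L) := by rw [pow_mul, hρ2, pow_succ, mul_comm]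
    have h3 : (2 : ℝ) ^ ((n - 1) / L) ≤ n * T.profile n := by exact_mod_cast h n hn
    have h4 : (n : ℝ) * (ρ - 1) ≤ ρ ^ n := by
      have := one_add_mul_le_pow (a := ρ - 1) (by linarith) n
      rw [add_sub_cancel] at this
      linarith
    have hn' : (0 : ℝ) < n := by exact_mod_cast hn
    have h5 : (n : ℝ) * ((ρ - 1) * ρ ^ n) ≤ n * (2 * T.profile n) := by
      calc (n : ℝ) * ((ρ - 1) * ρ ^ n) = (n * (ρ - 1)) * ρ ^ n := by ring
        _ ≤ ρ ^ n * ρ ^ n := by gcongr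
        _ ≤ 2 * (n * T.profile n) := h2.trans (by gcongr)
        _ = _ := by ring
    have := le_of_mul_le_mul_left h5 hn'
    linarith

/-- The vertex coded by an element of `Fin N ⊕ (Fin m × Fin s ⊕ Unit)`: a vertex of a fixed chain,
a vertex of the letter chosen by a word `w`, or a fixed point. -/
def codeVertex {N m s : ℕ} (b : ℕ → V) (d : ℕ → Fin s → V) (p : V) (w : Fin m → Fin 2) :
    Fin N ⊕ (Fin m × Fin s ⊕ Unit) → V
  | .inl j => b j
  | .inr (.inl (i, t)) => d (2 * i + w i) t
  | .inr (.inr _) => p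

/-- A word is determined by the isomorphism type of the subtournament it codes, provided that the
chain can be recognized in it and that distinct letters cut the chain differently. -/
theorem two_pow_le_mul_profile {N m s : ℕ} (hs : 0 < s) (b : ℕ → V) (d : ℕ → Fin s → V) (p : V)
    (hb : ∀ i j, i < j → j < N → T.Adj (b i) (b j))
    (hd : ∀ k k' t t', k < 2 * m → k' < 2 * m →
      (∀ j < N, T.Adj (d k t) (b j) ↔ T.Adj (d k' t') (b j)) → k = k')
    (hinj : ∀ w : Fin m → Fin 2,
      Function.Injective (codeVertex (N := N) b d p w))
    (hrec : ∀ (w w' : Fin m → Fin 2) (e : Equiv.Perm (Fin N ⊕ (Fin m × Fin s ⊕ Unit))),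
      e (.inr (.inr ())) = .inr (.inr ()) →
      (∀ i j, T.Adj (codeVertex b d p w i) (codeVertex b d p w j) ↔
        T.Adj (codeVertex b d p w' (e i)) (codeVertex b d p w' (e j))) →
      ∀ j y, e (.inl j) ≠ .inr (.inl y)) :
    2 ^ m ≤ (N + (m * s + 1)) * T.profile (N + (m * s + 1)) := by
  have hbm : ∀ i j : Fin N, T.Adj (b i) (b j) ↔ i < j := by
    intro i j
    refine ⟨fun h => ?_, fun h => hb i j h j.2⟩
    by_contra hij
    rcases (not_lt.1 hij).lt_or_eq with h' | h'
    · exact T.not_adj_of_adj (hb j i h' i.2) h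
    · exact T.irrefl _ (h' ▸ h)
  have := T.card_le_mul_profile (fun w : Fin m → Fin 2 => ⟨codeVertex (N := N) b d p w, hinj w⟩)
    (.inr (.inr ())) (fun w w' e hp he => by
      have hB : ∀ j, ∃ j', e (.inl j) = .inl j' := by
        intro j
        rcases h : e (.inl j) with j' | y | u
        · exact ⟨j', rfl⟩
        · exact absurd h (hrec w w' e hp he j y)
        · exact absurd (e.injective (h.trans hp.symm)) (by simp)
      choose f hf using hB
      have hmono : StrictMono f := by
        intro i j hij
        have h1 := (he (.inl i) (.inl j)).1 (hb i j hij j.2)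
        rw [hf, hf] at h1
        exact (hbm _ _).1 h1
      -- A finite chain is rigid, so a letter and its image cut the same chain in the same way.
      have hfid : ∀ j, f j = j := fun j => by
        have hsurj : Function.Surjective f := Finite.surjective_of_injective hmono.injective
        have h2 := Subsingleton.elim (StrictMono.orderIsoOfSurjective f hmono hsurj)
          (OrderIso.refl (Fin N))
        exact DFunLike.congr_fun h2 j
      have hfix : ∀ j, e (.inl j) = .inl j := fun j => by rw [hf, hfid]
      funext i
      rcases h : e (.inr (.inl (i, ⟨0, hs⟩))) with j | ⟨i', t'⟩ | u
      · exact absurd (e.injective (h.trans (hfix j).symm)) (by simp)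
      · have hrow := hd (2 * i + w i) (2 * i' + w' i') ⟨0, hs⟩ t' (by omega) (by omega)
          (fun j hj => by
            have h1 := he (.inr (.inl (i, ⟨0, hs⟩))) (.inl ⟨j, hj⟩)
            rw [h, hfix] at h1
            exact h1)
        have hi : i = i' := Fin.ext (by omega)
        subst hi
        exact Fin.ext (by omega)
      · exact absurd (e.injective (h.trans hp.symm)) (by simp))
  simpa using this

/-! ### Two configurations that code words -/

/-- Growth from letters with one vertex, where a point separates the letters from the chain. -/
theorem growth_of_separated [Infinite V]
    (h : ∀ N, ∃ (b d : ℕ → V) (p : V), (∀ i j, i < j → j < N → T.Adj (b i) (b j)) ∧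
      (∀ k k', k < k' → k' < N → ∃ j < N, ¬ (T.Adj (d k) (b j) ↔ T.Adj (d k') (b j))) ∧
      ((∀ j < N, T.Adj p (b j) ∧ T.Adj (d j) p) ∨ (∀ j < N, T.Adj (b j) p ∧ T.Adj p (d j)))) :
    GrowthAtLeastExponential T.profile := by
  refine T.growthAtLeastExponential_of_two_pow_le 3 (by norm_num) fun n hn => ?_
  -- One vertex per letter and two chain vertices per letter, so that the chain can tell 2m letters
  -- apart; the rest of the n vertices lengthens the chain.
  set m := (n - 1) / 3 with hm
  obtain ⟨N, hN⟩ : ∃ N, N + (m * 1 + 1) = n := ⟨n - (m * 1 + 1), by omega⟩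
  have hNm : 2 * m ≤ N := by omega
  obtain ⟨b, d, p, hb, hd, hp⟩ := h N
  have hd' : ∀ k k', k < 2 * m → k' < 2 * m →
      (∀ j < N, T.Adj (d k) (b j) ↔ T.Adj (d k') (b j)) → k = k' := by
    intro k k' hk hk' h
    rcases lt_trichotomy k k' with hlt | heq | hlt
    · obtain ⟨j, hj, hne⟩ := hd k k' hlt (by omega)
      exact absurd (h j hj) hne
    · exact heq
    · obtain ⟨j, hj, hne⟩ := hd k' k hlt (by omega)
      exact absurd (h j hj).symm hne
  have hbp : ∀ j < N, b j ≠ p := fun j hj => by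
    rcases hp with hp | hp
    · exact (T.ne_of_adj (hp j hj).1).symm
    · exact T.ne_of_adj (hp j hj).1
  have hdp : ∀ j < N, d j ≠ p := fun j hj => by
    rcases hp with hp | hp
    · exact T.ne_of_adj (hp j hj).2
    · exact (T.ne_of_adj (hp j hj).2).symm
  have hbd : ∀ j < N, ∀ k < N, b j ≠ d k := fun j hj k hk e => by
    rcases hp with hp | hp
    · exact T.not_adj_of_adj (hp j hj).1 (e ▸ (hp k hk).2)
    · exact T.not_adj_of_adj (hp j hj).1 (e ▸ (hp k hk).2)
  have hbi : ∀ i < N, ∀ j < N, b i = b j → i = j := fun i hi j hj e => by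
    rcases lt_trichotomy i j with hlt | heq | hlt
    · exact absurd e (T.ne_of_adj (hb i j hlt hj))
    · exact heq
    · exact absurd e.symm (T.ne_of_adj (hb j i hlt hi))
  have := T.two_pow_le_mul_profile (N := N) (m := m) (s := 1) one_pos b (fun k _ => d k) p hb
    (fun k k' _ _ hk hk' h => hd' k k' hk hk' h) ?_ ?_
  · rwa [hN] at this
  · intro w
    rintro (j | ⟨i, t⟩ | u) (j' | ⟨i', t'⟩ | u') h
    · exact congrArg _ (Fin.ext (hbi j j.2 j' j'.2 h))
    · exact absurd h (hbd j j.2 _ (by omega))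
    · exact absurd h (hbp j j.2)
    · exact absurd h.symm (hbd j' j'.2 _ (by omega))
    · have h1 := hd' (2 * i + w i) (2 * i' + w i') (by omega) (by omega) (fun j _ => by
        have h2 : d (2 * i + w i) = d (2 * i' + w i') := h
        rw [h2])
      have hi : i = i' := Fin.ext (by omega)
      rw [hi, Subsingleton.elim t t']
    · exact absurd h (hdp _ (by omega))
    · exact absurd h.symm (hbp j' j'.2)
    · exact absurd h.symm (hdp _ (by omega))
    · rfl
  · rintro w w' e hep he j ⟨i, t⟩ h
    rcases hp with hp | hp
    · have h1 := (he (.inr (.inr ())) (.inl j)).1 (hp j j.2).1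
      rw [hep, h] at h1
      exact T.not_adj_of_adj h1 (hp (2 * i + w' i) (by omega)).2
    · have h1 := (he (.inl j) (.inr (.inr ()))).1 (hp j j.2).1
      rw [hep, h] at h1
      exact T.not_adj_of_adj h1 (hp (2 * i + w' i) (by omega)).2

/-- Growth from a lexicographic sum of three-cycles over a chain. -/
theorem growth_of_sum_threeCycles [Infinite V] (W : ℕ → Fin 3 → V)
    (hW : ∀ i j s t, i < j → T.Adj (W i s) (W j t))
    (hc : ∀ i t, T.Adj (W i t) (W i (t + 1))) :
    GrowthAtLeastExponential T.profile := by
  refine T.growthAtLeastExponential_of_two_pow_le 5 (by norm_num) fun n hn => ?_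
  -- Three vertices per letter and two chain vertices per letter.
  set m := (n - 1) / 5 with hm
  obtain ⟨N, hN⟩ : ∃ N, N + (m * 3 + 1) = n := ⟨n - (m * 3 + 1), by omega⟩
  have hNm : 2 * m ≤ N := by omega
  have hlt : ∀ i j s t, i ≠ j → T.Adj (W i s) (W j t) → i < j := by
    intro i j s t hij h
    by_contra hn
    exact T.not_adj_of_adj (hW j i t s (by omega)) h
  -- `c` is the block and `τ` the position in it: letters fill even blocks, the chain and the marked
  -- point use one vertex of odd blocks.
  let c : (Fin m → Fin 2) → Fin N ⊕ (Fin m × Fin 3 ⊕ Unit) → ℕ := fun w a =>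
    match a with
    | .inl j => 2 * j + 1
    | .inr (.inl (i, _)) => 2 * (2 * i + w i)
    | .inr (.inr _) => 2 * N + 1
  let τ : Fin N ⊕ (Fin m × Fin 3 ⊕ Unit) → Fin 3 := fun a =>
    match a with
    | .inl j => 0
    | .inr (.inl (_, t)) => t
    | .inr (.inr _) => 0
  have hcode : ∀ w a, codeVertex (N := N) (fun j => W (2 * j + 1) 0) (fun k => W (2 * k))
      (W (2 * N + 1) 0) w a = W (c w a) (τ a) := by
    rintro w (j | ⟨i, t⟩ | u) <;> rfl
  have hcinj : ∀ w j a, c w (.inl j) = c w a → a = .inl j := by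
    rintro w j (j' | ⟨i, t⟩ | u) h
    · exact congrArg _ (Fin.ext (by simp only [c] at h; omega))
    · simp only [c] at h; omega
    · simp only [c] at h; omega
  have := T.two_pow_le_mul_profile (N := N) (m := m) (s := 3) (by norm_num)
    (fun j => W (2 * j + 1) 0) (fun k => W (2 * k)) (W (2 * N + 1) 0)
    (fun i j hij _ => hW _ _ _ _ (by omega)) ?_ ?_ ?_
  · rwa [hN] at this
  · have key : ∀ k k' t t', k < k' → k' < 2 * m →
        (∀ j < N, T.Adj (W (2 * k) t) (W (2 * j + 1) 0) ↔ T.Adj (W (2 * k') t') (W (2 * j + 1) 0)) →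
        False := by
      intro k k' t t' hk hk' h
      have := hlt _ _ _ _ (by omega) ((h k (by omega)).1 (hW _ _ _ _ (by omega)))
      omega
    intro k k' t t' hk hk' h
    rcases lt_trichotomy k k' with h1 | h1 | h1
    · exact (key k k' t t' h1 hk' h).elim
    · exact h1
    · exact (key k' k t' t h1 hk (fun j hj => (h j hj).symm)).elim
  · have hinj : ∀ i j s t, W i s = W j t → i = j ∧ s = t := by
      intro i j s t h
      have hij : i = j := by
        by_contra hij
        rcases lt_or_gt_of_ne hij with h1 | h1
        · exact T.ne_of_adj (hW i j s t h1) h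
        · exact T.ne_of_adj (hW j i t s h1) h.symm
      subst hij
      refine ⟨rfl, ?_⟩
      by_contra hst
      have h3 : t = s + 1 ∨ s = t + 1 := by omega
      rcases h3 with rfl | rfl
      · exact T.ne_of_adj (hc i s) h
      · exact T.ne_of_adj (hc i t) h.symm
    intro w a a' h
    rw [hcode, hcode] at h
    obtain ⟨h1, h2⟩ := hinj _ _ _ _ h
    rcases a with j | ⟨i, t⟩ | u <;> rcases a' with j' | ⟨i', t'⟩ | u' <;>
      simp only [c, τ] at h1 h2
    · exact congrArg _ (Fin.ext (by omega))
    · omega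
    · omega
    · omega
    · have hi : i = i' := Fin.ext (by omega)
      rw [hi, h2]
    · omega
    · omega
    · omega
    · rfl
  -- A letter vertex lies on a three-cycle; a chain vertex, alone in its block, lies on none.
  · rintro w w' e - he j ⟨i, t⟩ h
    simp only [hcode] at he
    obtain ⟨a, ha⟩ := e.surjective (.inr (.inl (i, t + 1)))
    obtain ⟨a', ha'⟩ := e.surjective (.inr (.inl (i, t + 2)))
    have h1 := (he (.inl j) a).2 (by rw [h, ha]; exact hc _ _)
    have h2 := (he a a').2 (by
      rw [ha, ha']
      have := hc (2 * (2 * i + w' i)) (t + 1)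
      rwa [add_assoc] at this)
    have h3 := (he a' (.inl j)).2 (by
      rw [ha', h]
      have := hc (2 * (2 * i + w' i)) (t + 2)
      rwa [add_assoc, show (2 + 1 : Fin 3) = 0 from rfl, add_zero] at this)
    have ne1 : c w (.inl j) ≠ c w a := fun e1 => by
      rw [hcinj w j a e1, h] at ha
      simp at ha
    have ne2 : c w (.inl j) ≠ c w a' := fun e1 => by
      rw [hcinj w j a' e1, h] at ha'
      simp at ha'
    have l1 := hlt _ _ _ _ ne1 h1
    have l3 := hlt _ _ _ _ ne2.symm h3
    exact T.not_adj_of_adj (hW _ _ _ _ (l3.trans l1)) h2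

/-! ### Homogeneous sequences -/

/-- Every term of `u` dominates the later terms of `v`. -/
def Before (u v : ℕ → V) : Prop := ∀ i j, i < j → T.Adj (u i) (v j)

/-- Every term of `u` is dominated by the later terms of `v`. -/
def After (u v : ℕ → V) : Prop := ∀ i j, i < j → T.Adj (v j) (u i)

/-- The relation between a term of `u` and a later term of `v` does not depend on the terms. -/
def Homogeneous (u v : ℕ → V) : Prop :=
  T.Before u v ∨ T.After u v ∨ ∀ i j, i < j → u i = v j

variable {T}

/-- Even terms of `x` form the chain and odd terms of `d` the letters, so that distinct letters are
told apart by the chain term following the earlier one. -/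
theorem growth_of_interleaved [Infinite V] {x d : ℕ → V} (hx : T.Before x x)
    (hd : (T.Before d x ∧ T.Before x d) ∨ (T.After d x ∧ T.After x d))
    (hp : ∀ N, ∃ p, (∀ i, 0 < i → i < N → T.Adj p (x i) ∧ T.Adj (d i) p) ∨
      (∀ i, 0 < i → i < N → T.Adj (x i) p ∧ T.Adj p (d i))) :
    GrowthAtLeastExponential T.profile := by
  refine T.growth_of_separated fun N => ?_
  obtain ⟨p, hp⟩ := hp (2 * N + 2)
  refine ⟨fun j => x (2 * j + 2), fun k => d (2 * k + 1), p, fun i j hij _ => hx _ _ (by omega),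
    fun k k' hk hk' => ⟨k, by omega, fun h => ?_⟩, ?_⟩
  · rcases hd with ⟨h1, h2⟩ | ⟨h1, h2⟩
    · exact T.not_adj_of_adj (h2 (2 * k + 2) (2 * k' + 1) (by omega))
        (h.1 (h1 _ _ (by omega)))
    · exact T.not_adj_of_adj (h1 (2 * k + 1) (2 * k + 2) (by omega))
        (h.2 (h2 _ _ (by omega)))
  · rcases hp with hp | hp
    · exact Or.inl fun j hj => ⟨(hp _ (by omega) (by omega)).1, (hp _ (by omega) (by omega)).2⟩
    · exact Or.inr fun j hj => ⟨(hp _ (by omega) (by omega)).1, (hp _ (by omega) (by omega)).2⟩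

theorem growth_of_after_after [Infinite V] {x v : ℕ → V} (hx : T.Before x x)
    (h1 : T.After v x) (h2 : T.After x v) : GrowthAtLeastExponential T.profile :=
  growth_of_interleaved hx (Or.inr ⟨h1, h2⟩) fun _ =>
    ⟨x 0, Or.inl fun i hi _ => ⟨hx 0 i hi, h2 0 i hi⟩⟩

theorem growth_of_reversed [Infinite V] {x v : ℕ → V} (hx : T.Before x x)
    (h1 : T.Before v x) (h2 : T.Before x v) (hv : T.After v v) :
    GrowthAtLeastExponential T.profile :=
  growth_of_interleaved hx (Or.inl ⟨h1, h2⟩) fun _ =>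
    ⟨v 0, Or.inl fun i hi _ => ⟨h1 0 i hi, hv 0 i hi⟩⟩

theorem growth_of_split [Infinite V] {x y v : ℕ → V} (hx : T.Before x x)
    (hxy : T.Before x y) (hyx : T.Before y x)
    (h : (T.Before v x ∧ T.After v y) ∨ (T.After v x ∧ T.Before v y) ∨
      (T.Before x v ∧ T.After y v) ∨ (T.After x v ∧ T.Before y v)) :
    GrowthAtLeastExponential T.profile := by
  refine growth_of_interleaved hx (Or.inl ⟨hyx, hxy⟩) fun N => ?_
  rcases h with ⟨h1, h2⟩ | ⟨h1, h2⟩ | ⟨h1, h2⟩ | ⟨h1, h2⟩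
  · exact ⟨v 0, Or.inl fun i hi _ => ⟨h1 0 i hi, h2 0 i hi⟩⟩
  · exact ⟨v 0, Or.inr fun i hi _ => ⟨h1 0 i hi, h2 0 i hi⟩⟩
  -- Here only the relation to later terms of `v` is known, so the point is taken beyond all the
  -- indices used.
  · exact ⟨v N, Or.inr fun i _ hi => ⟨h1 i N hi, h2 i N hi⟩⟩
  · exact ⟨v N, Or.inl fun i _ hi => ⟨h1 i N hi, h2 i N hi⟩⟩

/-- A perfect matching between a chain and a homogeneous sequence yields growth. -/
theorem growth_of_matched [Infinite V] {x v : ℕ → V} (hx : T.Before x x)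
    (hv : T.Before v v ∨ T.After v v)
    (h : (T.Before v x ∧ T.After x v ∧ ∀ i, T.Adj (x i) (v i)) ∨
      (T.After v x ∧ T.Before x v ∧ ∀ i, T.Adj (v i) (x i))) :
    GrowthAtLeastExponential T.profile := by
  have hrow : ∀ k k', k < k' → ¬ (T.Adj (v k) (x k) ↔ T.Adj (v k') (x k)) := by
    intro k k' hk e
    rcases h with ⟨h1, h2, h3⟩ | ⟨h1, h2, h3⟩
    · exact T.not_adj_of_adj (h3 k) (e.2 (h2 _ _ hk))
    · exact T.not_adj_of_adj (h2 _ _ hk) (e.1 (h3 k))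
  refine T.growth_of_separated fun N => ⟨fun j => x (j + 1), fun k => v (k + 1), ?_⟩
  have hb : ∀ i j, i < j → j < N → T.Adj (x (i + 1)) (x (j + 1)) :=
    fun i j hij _ => hx _ _ (by omega)
  have hd : ∀ k k', k < k' → k' < N →
      ∃ j < N, ¬ (T.Adj (v (k + 1)) (x (j + 1)) ↔ T.Adj (v (k' + 1)) (x (j + 1))) :=
    fun k k' hk hk' => ⟨k, by omega, hrow _ _ (by omega)⟩
  rcases h with ⟨h1, h2, -⟩ | ⟨h1, h2, -⟩ <;> rcases hv with hv | hv
  · exact ⟨v (N + 1), hb, hd, Or.inl fun j hj =>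
      ⟨h2 (j + 1) (N + 1) (by omega), hv (j + 1) (N + 1) (by omega)⟩⟩
  · exact ⟨v 0, hb, hd, Or.inl fun j hj => ⟨h1 0 (j + 1) (by omega), hv 0 (j + 1) (by omega)⟩⟩
  · exact ⟨v 0, hb, hd, Or.inr fun j hj => ⟨h1 0 (j + 1) (by omega), hv 0 (j + 1) (by omega)⟩⟩
  · exact ⟨v (N + 1), hb, hd, Or.inr fun j hj =>
      ⟨h2 (j + 1) (N + 1) (by omega), hv (j + 1) (N + 1) (by omega)⟩⟩

/-- In the case of equality, two terms of `u` equal a common later term of `v`, and two terms of `v`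
a common earlier term of `u`; a chain has no repetition. -/
theorem Homogeneous.before_or_after {u v : ℕ → V} (h : T.Homogeneous u v)
    (hv : T.Before u u ∨ T.Before v v) : T.Before u v ∨ T.After u v := by
  rcases h with h | h | h
  · exact Or.inl h
  · exact Or.inr h
  · rcases hv with hv | hv
    · exact absurd ((h 0 2 (by omega)).trans (h 1 2 (by omega)).symm)
        (T.ne_of_adj (hv 0 1 (by omega)))
    · exact absurd ((h 0 1 (by omega)).symm.trans (h 0 2 (by omega)))
        (T.ne_of_adj (hv 1 2 (by omega)))

/-- If the profile does not grow exponentially, a homogeneous sequence whose terms separate, in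
every column, the two terms of a doubled chain has its terms in the place of their columns. -/
theorem before_of_not_growth [Infinite V] (hg : ¬ GrowthAtLeastExponential T.profile)
    {x y v : ℕ → V} (hx : T.Before x x) (hy : T.Before y y) (hxy : T.Before x y)
    (hyx : T.Before y x) (hvx : T.Homogeneous v x) (hxv : T.Homogeneous x v)
    (hvy : T.Homogeneous v y) (hyv : T.Homogeneous y v) (hvv : T.Homogeneous v v)
    (h : (∀ i, T.Adj (x i) (v i) ∧ T.Adj (v i) (y i)) ∨
      (∀ i, T.Adj (v i) (x i) ∧ T.Adj (y i) (v i))) :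
    T.Before v x ∧ T.Before x v ∧ T.Before v y ∧ T.Before y v ∧ T.Before v v := by
  have hsplit := fun h => hg (growth_of_split (v := v) hx hxy hyx h)
  have e1 := hvx.before_or_after (Or.inr hx)
  have e2 := hxv.before_or_after (Or.inl hx)
  have e3 := hvy.before_or_after (Or.inr hy)
  have e4 := hyv.before_or_after (Or.inl hy)
  have hconst : T.Before v v ∨ T.After v v := by
    rcases hvv with h' | h' | h'
    · exact Or.inl h'
    · exact Or.inr h'
    · exfalso
      -- Now `v 1` relates to `x 1` and `y 1` as `v 0` does; since it separates them, `v` splits `x`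
      -- from `y`.
      have e : v 0 = v 1 := h' 0 1 (by omega)
      refine hsplit ?_
      rcases e1 with e1 | e1 <;> rcases e3 with e3 | e3
      · exfalso
        have hx1 := e1 0 1 (by omega)
        have hy1 := e3 0 1 (by omega)
        rw [e] at hx1 hy1
        rcases h with h | h
        · exact T.not_adj_of_adj hx1 (h 1).1
        · exact T.not_adj_of_adj hy1 (h 1).2
      · exact Or.inl ⟨e1, e3⟩
      · exact Or.inr (Or.inl ⟨e1, e3⟩)
      · exfalso
        have hx1 := e1 0 1 (by omega)
        have hy1 := e3 0 1 (by omega)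
        rw [e] at hx1 hy1
        rcases h with h | h
        · exact T.not_adj_of_adj hy1 (h 1).2
        · exact T.not_adj_of_adj hx1 (h 1).1
  have f1 : T.Before v x → T.Before v y := fun h1 =>
    e3.resolve_right fun h2 => hsplit (Or.inl ⟨h1, h2⟩)
  have f2 : T.After v x → T.After v y := fun h1 =>
    e3.resolve_left fun h2 => hsplit (Or.inr (Or.inl ⟨h1, h2⟩))
  have f3 : T.Before x v → T.Before y v := fun h1 =>
    e4.resolve_right fun h2 => hsplit (Or.inr (Or.inr (Or.inl ⟨h1, h2⟩)))
  have f4 : T.After x v → T.After y v := fun h1 =>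
    e4.resolve_left fun h2 => hsplit (Or.inr (Or.inr (Or.inr ⟨h1, h2⟩)))
  -- In the mixed cases all off-diagonal relations of `v` to `x` and `y` agree, and the column
  -- condition reverses the diagonal for one of the two: a perfect matching.
  rcases e1 with e1 | e1 <;> rcases e2 with e2 | e2
  · exact ⟨e1, e2, f1 e1, f3 e2,
      hconst.resolve_right fun hv => hg (growth_of_reversed hx e1 e2 hv)⟩
  · rcases h with h | h
    · exact absurd (growth_of_matched hx hconst (Or.inl ⟨e1, e2, fun i => (h i).1⟩)) hg
    · exact absurd (growth_of_matched hy hconst (Or.inl ⟨f1 e1, f4 e2, fun i => (h i).2⟩)) hg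
  · rcases h with h | h
    · exact absurd (growth_of_matched hy hconst (Or.inr ⟨f2 e1, f3 e2, fun i => (h i).2⟩)) hg
    · exact absurd (growth_of_matched hx hconst (Or.inr ⟨e1, e2, fun i => (h i).1⟩)) hg
  · exact absurd (growth_of_after_after hx e1 e2) hg

/-- A doubled chain with a homogeneous sequence completing its columns to three-cycles. -/
theorem growth_of_threeCycles [Infinite V] {x y z : ℕ → V} (hx : T.Before x x)
    (hy : T.Before y y) (hxy : T.Before x y) (hyx : T.Before y x) (hzx : T.Homogeneous z x)
    (hxz : T.Homogeneous x z) (hzy : T.Homogeneous z y) (hyz : T.Homogeneous y z)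
    (hzz : T.Homogeneous z z) (h : ∀ i, T.Adj (x i) (y i))
    (h' : ∀ i, T.Adj (z i) (x i) ∧ T.Adj (y i) (z i)) :
    GrowthAtLeastExponential T.profile := by
  by_contra hg
  obtain ⟨h1, h2, h3, h4, h5⟩ :=
    before_of_not_growth hg hx hy hxy hyx hzx hxz hzy hyz hzz (Or.inr h')
  refine hg (T.growth_of_sum_threeCycles (fun i => ![x i, y i, z i]) ?_ ?_)
  · intro i j s t hij
    fin_cases s <;> fin_cases t
    exacts [hx i j hij, hxy i j hij, h2 i j hij, hyx i j hij, hy i j hij, h4 i j hij,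
      h1 i j hij, h3 i j hij, h5 i j hij]
  · intro i t
    fin_cases t
    exacts [h i, (h' i).2, (h' i).1]

/-! ### Three-cycles from indecomposability -/

/-- Two vertices of an infinite indecomposable tournament lie close to a three-cycle. -/
theorem IsIndecomposable.exists_threeCycle [Infinite V] (hT : T.IsIndecomposable) {x y : V}
    (hxy : T.Adj x y) :
    ∃ u z, (T.Adj y z ∧ T.Adj z x) ∨
      (T.Adj x u ∧ T.Adj u y ∧ T.Adj u z ∧ T.Adj z x) ∨
      (T.Adj x u ∧ T.Adj u y ∧ T.Adj y z ∧ T.Adj z u) := by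
  by_contra! hno
  -- The closed interval from x to y: a vertex outside it that distinguishes two of its members
  -- creates one of the three-cycles.
  let A : Set V := {s | s = x ∨ s = y ∨ (T.Adj x s ∧ T.Adj s y)}
  have key : ∀ s ∈ A, ∀ s' ∈ A, ∀ z ∉ A, T.Adj s z → T.Adj s' z := by
    intro s hs s' hs' z hz hsz
    by_contra h'
    have hzx : z ≠ x := fun e => hz (Or.inl e)
    have hzy : z ≠ y := fun e => hz (Or.inr (Or.inl e))
    have hz' : T.Adj z s' := T.adj_of_not_adj (fun e => hz (e ▸ hs')) h'
    have hn : ¬ (T.Adj x z ∧ T.Adj z y) := fun e => hz (Or.inr (Or.inr e))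
    rcases T.complete x z hzx.symm with h1 | h1
    · have h2 : T.Adj y z := T.adj_of_not_adj hzy fun e => hn ⟨h1, e⟩
      rcases hs' with rfl | rfl | ⟨h3, h4⟩
      · exact h' h1
      · exact h' h2
      · exact (hno s' z).2.2 h3 h4 h2 hz'
    · rcases T.complete y z hzy.symm with h2 | h2
      · exact (hno x z).1 h2 h1
      · rcases hs with rfl | rfl | ⟨h3, h4⟩
        · exact T.not_adj_of_adj h1 hsz
        · exact T.not_adj_of_adj h2 hsz
        · exact (hno s z).2.1 h3 h4 hsz h1
  rcases hT A fun s hs s' hs' z hz => ⟨key s hs s' hs' z hz, key s' hs' s hs z hz⟩ with h | ⟨a, h⟩ | h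
  · have : x ∈ A := Or.inl rfl
    rw [h] at this
    exact this
  · have h1 : x ∈ A := Or.inl rfl
    have h2 : y ∈ A := Or.inr (Or.inl rfl)
    rw [h] at h1 h2
    exact T.ne_of_adj hxy (h1.trans h2.symm)
  -- If the interval is everything, x dominates all other vertices, whose set is then a nontrivial
  -- autonomous set.
  · have hdom : ∀ s, s ≠ x → T.Adj x s := by
      intro s hs
      have : s ∈ A := h ▸ Set.mem_univ s
      rcases this with e | rfl | e
      · exact absurd e hs
      · exact hxy
      · exact e.1
    rcases hT {x}ᶜ (fun s hs s' hs' z hz => by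
      have hz : z = x := by simpa using hz
      subst hz
      exact ⟨fun e => absurd e (T.not_adj_of_adj (hdom s hs)),
        fun e => absurd e (T.not_adj_of_adj (hdom s' hs'))⟩) with h1 | ⟨a, h1⟩ | h1
    · have : y ∈ ({x}ᶜ : Set V) := (T.ne_of_adj hxy).symm
      rw [h1] at this
      exact this
    · exact Set.infinite_of_finite_compl (s := ({x}ᶜ : Set V)) (by simp)
        (h1 ▸ Set.finite_singleton a)
    · have : x ∈ ({x}ᶜ : Set V) := h1 ▸ Set.mem_univ x
      exact this rfl

/-! ### Ramsey reduction -/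

/-- A tournament on an infinite vertex set contains an infinite increasing or decreasing chain. -/
theorem exists_before_or_after [Infinite V] (T : Tournament V) :
    ∃ a : ℕ → V, T.Before a a ∨ T.After a a := by
  let a := Infinite.natEmbedding V
  obtain ⟨φ, c, hφ, h⟩ := exists_strictMono_monochromatic fun i j => T.Adj (a i) (a j)
  refine ⟨a ∘ φ, ?_⟩
  by_cases hc : c
  · exact Or.inl fun i j hij => (h i j hij).symm ▸ hc
  · exact Or.inr fun i j hij => T.adj_of_not_adj
      (fun e => (hφ hij).ne (a.injective e)) (by
        have := h i j hij
        simp only [Function.comp]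
        rw [this]
        exact hc)

theorem IsIndecomposable.growth_of_before [Infinite V] (hT : T.IsIndecomposable) {a : ℕ → V}
    (ha : T.Before a a) : GrowthAtLeastExponential T.profile := by
  choose u z h using fun i => hT.exists_threeCycle (ha (2 * i) (2 * i + 1) (by omega))
  let W : ℕ → Fin 4 → V := fun i => ![a (2 * i), a (2 * i + 1), u i, z i]
  -- The third component ignores `j`: it makes all the selected columns internally alike, so that
  -- inspecting column 0 suffices.
  obtain ⟨φ, c, hφ, hc⟩ := exists_strictMono_monochromatic
    (κ := (Fin 4 → Fin 4 → Prop) × (Fin 4 → Fin 4 → Prop) × (Fin 4 → Fin 4 → Prop)) fun i j =>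
      (fun s t => T.Adj (W i s) (W j t), fun s t => T.Adj (W j t) (W i s),
        fun s t => T.Adj (W i s) (W i t))
  let X : Fin 4 → ℕ → V := fun s i => W (φ i) s
  have hom : ∀ s t, T.Homogeneous (X s) (X t) := by
    intro s t
    by_cases h1 : c.1 s t
    · exact Or.inl fun i j hij => by
        have := congrFun (congrFun (congrArg Prod.fst (hc i j hij)) s) t
        exact (iff_of_eq this).2 h1
    by_cases h2 : c.2.1 s t
    · exact Or.inr (Or.inl fun i j hij => by
        have := congrFun (congrFun (congrArg (fun q => q.2.1) (hc i j hij)) s) t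
        exact (iff_of_eq this).2 h2)
    · refine Or.inr (Or.inr fun i j hij => ?_)
      have e1 := congrFun (congrFun (congrArg Prod.fst (hc i j hij)) s) t
      have e2 := congrFun (congrFun (congrArg (fun q => q.2.1) (hc i j hij)) s) t
      by_contra hne
      rcases T.complete _ _ hne with h | h
      · exact h1 ((iff_of_eq e1).1 h)
      · exact h2 ((iff_of_eq e2).1 h)
  have own : ∀ i s t, T.Adj (X s 0) (X t 0) → T.Adj (X s i) (X t i) := by
    intro i s t h0
    have e1 := congrFun (congrFun (congrArg (fun q => q.2.2) (hc i (i + 1) (by omega))) s) t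
    have e2 := congrFun (congrFun (congrArg (fun q => q.2.2) (hc 0 1 (by omega))) s) t
    exact (iff_of_eq (e1.trans e2.symm)).2 h0
  have h00 : T.Before (X 0) (X 0) := fun i j hij => ha _ _ (by have := hφ hij; omega)
  have h01 : T.Before (X 0) (X 1) := fun i j hij => ha _ _ (by have := hφ hij; omega)
  have h10 : T.Before (X 1) (X 0) := fun i j hij => ha _ _ (by have := hφ hij; omega)
  have h11 : T.Before (X 1) (X 1) := fun i j hij => ha _ _ (by have := hφ hij; omega)
  have h01' : ∀ i, T.Adj (X 0 i) (X 1 i) := fun i => ha _ _ (by omega)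
  by_contra hg
  -- Without growth, `u` falls into the place of its column, so that `x, u` or `u, y` can replace
  -- `x, y` as the doubled chain completed by `z`.
  have hu : T.Adj (X 0 0) (X 2 0) → T.Adj (X 2 0) (X 1 0) → _ := fun h1 h2 =>
    before_of_not_growth hg h00 h11 h01 h10 (hom 2 0) (hom 0 2) (hom 2 1) (hom 1 2) (hom 2 2)
      (Or.inl fun i => ⟨own i 0 2 h1, own i 2 1 h2⟩)
  rcases h (φ 0) with ⟨h1, h2⟩ | ⟨h1, h2, h3, h4⟩ | ⟨h1, h2, h3, h4⟩
  · exact hg (growth_of_threeCycles h00 h11 h01 h10 (hom 3 0) (hom 0 3) (hom 3 1) (hom 1 3)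
      (hom 3 3) h01' fun i => ⟨own i 3 0 h2, own i 1 3 h1⟩)
  · obtain ⟨g1, g2, -, -, g5⟩ := hu h1 h2
    exact hg (growth_of_threeCycles h00 g5 g2 g1 (hom 3 0) (hom 0 3) (hom 3 2) (hom 2 3)
      (hom 3 3) (fun i => own i 0 2 h1) fun i => ⟨own i 3 0 h4, own i 2 3 h3⟩)
  · obtain ⟨-, -, g3, g4, g5⟩ := hu h1 h2
    exact hg (growth_of_threeCycles g5 h11 g3 g4 (hom 3 2) (hom 2 3) (hom 3 1) (hom 1 3)
      (hom 3 3) (fun i => own i 2 1 h2) fun i => ⟨own i 3 2 h4, own i 1 3 h3⟩)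

end Tournament

theorem mainTheorem8 {V : Type*} [Infinite V] (T : Tournament V) (hT : T.IsIndecomposable) :
    GrowthAtLeastExponential T.profile := by
  obtain ⟨a, ha | ha⟩ := T.exists_before_or_after
  · exact hT.growth_of_before ha
  · rw [← T.profile_dual]
    exact hT.dual.growth_of_before (a := a) ha
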